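/- There is a universal constant $C>0$ such that the following holds. Let $k\ge 2$ be an integer, and for $u\in\mathbb{R}^k$ put $\mathsf{Rect}(u)=(-\infty,u_1]\times\cdots\times(-\infty,u_k]$; write $\mathsf{1}_k$ for the all-ones vector in $\mathbb{R}^k$. For a $C^\infty$ function $\psi:\mathbb{R}^k\to\mathbb{R}$ put $$\|\psi^{(4)}\|_1=\sup_{a\in\mathbb{R}^k}\ \sum_{p,q,r,s=1}^{k}\bigl|\partial_p\partial_q\partial_r\partial_s\psi(a)\bigr|.$$ Let $A,B$ be random vectors in $\mathbb{R}^k$ (possibly defined on different probability spaces), let $\Delta\in\mathbb{R}$, and let $g_k:[0,1]\to[0,1]$ be a function such that 1. for every $C^\infty$ function $\psi:\mathbb{R}^k\to\mathbb{R}$ with $\|\psi^{(4)}\|_1<\infty$ for which $\psi(A)$ and $\psi(B)$ are integrable, $\bigl|\mathbb{E}[\psi(A)]-\mathbb{E}[\psi(B)]\bigr|\le\Delta\,\|\psi^{(4)}\|_1$; 2. for every $\lambda\in[0,1]$, $\sup_{\theta\in\mathbb{R}^k}\Pr\bigl[B\in\mathsf{Rect}(\theta+\lambda\mathsf{1}_k)\setminus\mathsf{Rect}(\theta)\bigr]\le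 g_k(\lambda)$. Then for all $\theta\in\mathbb{R}^k$ and all $0<\lambda<1$, $$\bigl|\Pr[A\in\mathsf{Rect}(\theta)]-\Pr[B\in\mathsf{Rect}(\theta)]\bigr|\le \frac{C\,\Delta\,\log^3 k}{\lambda^4}+C\,g_k(\lambda).$$ -/

import Mathlib

open MeasureTheory

noncomputable section

namespace SmoothToRect

/-- The rectangle `(-∞, u₁] × ⋯ × (-∞, u_k]`. -/
def rect {k : ℕ} (u : Fin k → ℝ) : Set (Fin k → ℝ) :=
  {x | ∀ p, x p ≤ u p}

/-- The partial derivative `∂_p f`, as a function on `ℝ^k`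
(it is only applied to smooth functions). -/
def partialDeriv {k : ℕ} (p : Fin k) (f : (Fin k → ℝ) → ℝ) : (Fin k → ℝ) → ℝ :=
  fun x => fderiv ℝ f x (Pi.single p 1)

/-- The sum `∑_{p,q,r,s} |∂_p ∂_q ∂_r ∂_s ψ (a)|`. -/
def fourthDerivSum {k : ℕ} (ψ : (Fin k → ℝ) → ℝ) (a : Fin k → ℝ) : ℝ :=
  ∑ p, ∑ q, ∑ r, ∑ s,
    |partialDeriv p (partialDeriv q (partialDeriv r (partialDeriv s ψ))) a|

/-- The quantity `‖ψ⁽⁴⁾‖₁ = sup_a ∑_{p,q,r,s} |∂_p ∂_q ∂_r ∂_s ψ (a)|`; a real supremum, which is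
the honest one for the functions satisfying `IsSmoothTest`. -/
def fourthDerivNorm {k : ℕ} (ψ : (Fin k → ℝ) → ℝ) : ℝ :=
  ⨆ a, fourthDerivSum ψ a

open scoped ContDiff in
/-- A smooth test function: `C^∞`, with `‖ψ⁽⁴⁾‖₁ < ∞`. -/
def IsSmoothTest {k : ℕ} (ψ : (Fin k → ℝ) → ℝ) : Prop :=
  ContDiff ℝ ∞ ψ ∧ BddAbove (Set.range (fourthDerivSum ψ))

end SmoothToRect

end

/-!
Approximate the indicator of `rect θ` by a smooth step of the soft maximum
`β⁻¹ log ∑ exp (β (x_p - θ_p))`, which for `β = 2 log k / lam` overestimates `max (x_p - θ_p)` by at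
most `lam / 2`. The partial derivatives of log-sum-exp are polynomials in the softmax weights, which
are nonnegative with sum `1`, so the `ℓ¹` norm of its derivatives of each order is bounded
independently of `k`. Rescaling costs `β⁴`, and since in the scale of log-sum-exp the step extends
over a length of order `log k`, each of its derivatives gains back a factor `log k`; this leaves
`log³ k / lam⁴`. Smooth steps based at `θ` and at `θ - lam` give the upper and the lower bound.
-/

namespace SmoothToRect

variable {k : ℕ}

section PartialDerivatives

open scoped ContDiff

variable {f g : (Fin k → ℝ) → ℝ}

lemma contDiff_partialDeriv (hf : ContDiff ℝ ∞ f) (p : Fin k) :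
    ContDiff ℝ ∞ (partialDeriv p f) :=
  (hf.fderiv_right (m := ∞) (by simp)).clm_apply contDiff_const

lemma partialDeriv_add (hf : Differentiable ℝ f) (hg : Differentiable ℝ g) (p : Fin k) :
    partialDeriv p (fun x => f x + g x) = fun x => partialDeriv p f x + partialDeriv p g x := by
  funext x
  simp only [partialDeriv, fderiv_fun_add (hf x) (hg x), add_apply]

lemma partialDeriv_sub (hf : Differentiable ℝ f) (hg : Differentiable ℝ g) (p : Fin k) :
    partialDeriv p (fun x => f x - g x) = fun x => partialDeriv p f x - partialDeriv p g x := by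
  funext x
  simp only [partialDeriv, fderiv_fun_sub (hf x) (hg x), sub_apply]

lemma partialDeriv_mul (hf : Differentiable ℝ f) (hg : Differentiable ℝ g) (p : Fin k) :
    partialDeriv p (fun x => f x * g x)
      = fun x => f x * partialDeriv p g x + g x * partialDeriv p f x := by
  funext x
  simp only [partialDeriv, fderiv_fun_mul (hf x) (hg x), add_apply, smul_apply, smul_eq_mul]

lemma partialDeriv_const_mul (c : ℝ) (f : (Fin k → ℝ) → ℝ) (p : Fin k) :
    partialDeriv p (fun x => c * f x) = fun x => c * partialDeriv p f x := by
  funext x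
  have h : fderiv ℝ (fun x => c * f x) = c • fderiv ℝ f := fderiv_const_smul_field c
  simp only [partialDeriv, h, Pi.smul_apply, smul_apply, smul_eq_mul]

lemma partialDeriv_comp {G : ℝ → ℝ} (hG : ∀ x, DifferentiableAt ℝ G (f x))
    (hf : Differentiable ℝ f) (p : Fin k) :
    partialDeriv p (fun x => G (f x)) = fun x => deriv G (f x) * partialDeriv p f x := by
  funext x
  have h : HasFDerivAt (fun x => G (f x)) (deriv G (f x) • fderiv ℝ f x) x :=
    (hG x).hasDerivAt.comp_hasFDerivAt x (hf x).hasFDerivAt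
  simp only [partialDeriv, h.fderiv, smul_apply, smul_eq_mul]

lemma partialDeriv_exp (hf : Differentiable ℝ f) (p : Fin k) :
    partialDeriv p (fun x => Real.exp (f x)) = fun x => Real.exp (f x) * partialDeriv p f x := by
  rw [partialDeriv_comp (fun _ => Real.differentiableAt_exp) hf, Real.deriv_exp]

lemma partialDeriv_comp_smul_sub (f : (Fin k → ℝ) → ℝ) (β : ℝ) (θ : Fin k → ℝ) (p : Fin k) :
    partialDeriv p (fun x => f (β • (x - θ))) = fun x => β * partialDeriv p f (β • (x - θ)) := by
  funext x
  have h : fderiv ℝ (fun x => f (β • (x - θ))) x = β • fderiv ℝ f (β • (x - θ)) := by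
    rw [fderiv_comp_sub (f := fun x => f (β • x)), fderiv_comp_smul]
  simp only [partialDeriv, h, smul_apply, smul_eq_mul]

lemma partialDeriv_apply (i p : Fin k) :
    partialDeriv p (fun x => x i) = fun _ => if i = p then 1 else 0 := by
  funext x
  simp [partialDeriv, (hasFDerivAt_apply (𝕜 := ℝ) i x).fderiv, Pi.single_apply]

lemma partialDeriv_sum {ι : Type*} (s : Finset ι) {F : ι → (Fin k → ℝ) → ℝ}
    (hF : ∀ i ∈ s, Differentiable ℝ (F i)) (p : Fin k) :
    partialDeriv p (fun x => ∑ i ∈ s, F i x) = fun x => ∑ i ∈ s, partialDeriv p (F i) x := by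
  funext x
  simp only [partialDeriv, fderiv_fun_sum fun i hi => hF i hi x, sum_apply]

/-- The sum of the absolute values of all `n`-fold iterated partial derivatives. The recursion
peels off the innermost derivative, so for `n = 4` the order of summation is opposite to that of
`fourthDerivSum`. -/
noncomputable def derivSum : ℕ → ((Fin k → ℝ) → ℝ) → (Fin k → ℝ) → ℝ
  | 0, f, a => |f a|
  | n + 1, f, a => ∑ p, derivSum n (partialDeriv p f) a

lemma fourthDerivSum_eq_derivSum (ψ : (Fin k → ℝ) → ℝ) (a : Fin k → ℝ) :
    fourthDerivSum ψ a = derivSum 4 ψ a := by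
  simp only [fourthDerivSum, derivSum]
  rw [Finset.sum_congr rfl fun p _ => Finset.sum_comm_cycle, Finset.sum_comm]
  refine Finset.sum_congr rfl fun s _ => ?_
  rw [Finset.sum_comm_cycle]
  exact Finset.sum_congr rfl fun r _ => Finset.sum_comm

lemma derivSum_add_le (n : ℕ) (hf : ContDiff ℝ ∞ f) (hg : ContDiff ℝ ∞ g) (a : Fin k → ℝ) :
    derivSum n (fun x => f x + g x) a ≤ derivSum n f a + derivSum n g a := by
  induction n generalizing f g with
  | zero => exact abs_add_le _ _
  | succ n ih =>
    simp only [derivSum, ← Finset.sum_add_distrib]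
    refine Finset.sum_le_sum fun p _ => ?_
    rw [partialDeriv_add (hf.differentiable (by simp)) (hg.differentiable (by simp))]
    exact ih (contDiff_partialDeriv hf p) (contDiff_partialDeriv hg p)

lemma derivSum_const_mul (n : ℕ) (c : ℝ) (f : (Fin k → ℝ) → ℝ) (a : Fin k → ℝ) :
    derivSum n (fun x => c * f x) a = |c| * derivSum n f a := by
  induction n generalizing f with
  | zero => exact abs_mul _ _
  | succ n ih => simp only [derivSum, partialDeriv_const_mul, ih, Finset.mul_sum]

lemma derivSum_comp_smul_sub (n : ℕ) (f : (Fin k → ℝ) → ℝ) (β : ℝ) (θ a : Fin k → ℝ) :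
    derivSum n (fun x => f (β • (x - θ))) a = |β| ^ n * derivSum n f (β • (a - θ)) := by
  induction n generalizing f with
  | zero => simp only [derivSum, pow_zero, one_mul]
  | succ n ih =>
    simp only [derivSum, partialDeriv_comp_smul_sub, derivSum_const_mul, ih, Finset.mul_sum,
      pow_succ', mul_assoc]

lemma partialDeriv_comp_sum {G : ℝ → ℝ} (hG : Differentiable ℝ G) (p : Fin k) :
    partialDeriv p (fun x => G (∑ i, x i)) = fun x => deriv G (∑ i, x i) := by
  rw [partialDeriv_comp (f := fun x => ∑ i, x i) (fun _ => hG _) (by fun_prop),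
    partialDeriv_sum _ fun _ _ => by fun_prop]
  simp only [partialDeriv_apply, Finset.sum_ite_eq', Finset.mem_univ, if_true, mul_one]

lemma derivSum_comp_sum (n : ℕ) {G : ℝ → ℝ} (hG : ContDiff ℝ ∞ G) (a : Fin k → ℝ) :
    derivSum n (fun x => G (∑ i, x i)) a = k ^ n * |iteratedDeriv n G (∑ i, a i)| := by
  induction n generalizing G with
  | zero => simp [derivSum]
  | succ n ih =>
    simp only [derivSum, partialDeriv_comp_sum (hG.differentiable (by simp)),
      ih (contDiff_infty_iff_deriv.1 hG).2, Finset.sum_const, Finset.card_univ, Fintype.card_fin,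
      nsmul_eq_mul, iteratedDeriv_succ', pow_succ', mul_assoc]

end PartialDerivatives

section LogSumExp

open scoped ContDiff

variable {ι : Type*} [Fintype ι]

/-- The soft maximum `log ∑ᵢ exp xᵢ`, which exceeds `maxᵢ xᵢ` by at most `log |ι|`. -/
noncomputable def logSumExp (x : ι → ℝ) : ℝ := Real.log (∑ i, Real.exp (x i))

lemma le_logSumExp (x : ι → ℝ) (i : ι) : x i ≤ logSumExp x := by
  have h : Real.exp (x i) ≤ ∑ j, Real.exp (x j) :=
    Finset.single_le_sum (f := fun j => Real.exp (x j)) (fun j _ => (Real.exp_pos _).le)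
      (Finset.mem_univ i)
  exact (Real.le_log_iff_exp_le ((Real.exp_pos _).trans_le h)).2 h

/-- The softmax weight `exp xᵢ / ∑ⱼ exp xⱼ`, the `i`-th partial derivative of `logSumExp`, written
as a single exponential. -/
noncomputable def softmax (i : ι) (x : ι → ℝ) : ℝ := Real.exp (x i - logSumExp x)

/-- The monomial in the softmax weights whose factors are indexed, with multiplicity, by `m`;
it carries the polynomial dependence of the derivatives of `logSumExp` on the weights. -/
noncomputable def softmaxMonomial (m : Multiset ι) (x : ι → ℝ) : ℝ :=
  (m.map fun i => softmax i x).prod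

lemma softmaxMonomial_cons (i : ι) (m : Multiset ι) :
    softmaxMonomial (i ::ₘ m) = fun x => softmax i x * softmaxMonomial m x := by
  funext x
  simp only [softmaxMonomial, Multiset.map_cons, Multiset.prod_cons]

lemma softmaxMonomial_pos (m : Multiset ι) (x : ι → ℝ) : 0 < softmaxMonomial m x :=
  Multiset.prod_pos fun _ hw => by
    obtain ⟨i, -, rfl⟩ := Multiset.mem_map.1 hw
    exact Real.exp_pos _

variable [Nonempty ι]

lemma sum_exp_pos (x : ι → ℝ) : 0 < ∑ i, Real.exp (x i) :=
  Finset.sum_pos (fun _ _ => Real.exp_pos _) Finset.univ_nonempty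

lemma logSumExp_le {x : ι → ℝ} {b : ℝ} (hx : ∀ i, x i ≤ b) :
    logSumExp x ≤ Real.log (Fintype.card ι) + b := by
  have h : ∑ i, Real.exp (x i) ≤ Fintype.card ι * Real.exp b := by
    simpa using Finset.sum_le_sum fun i (_ : i ∈ Finset.univ) => Real.exp_le_exp.2 (hx i)
  calc logSumExp x ≤ Real.log (Fintype.card ι * Real.exp b) := Real.log_le_log (sum_exp_pos x) h
    _ = Real.log (Fintype.card ι) + b := by
      rw [Real.log_mul (by simp) (Real.exp_ne_zero b), Real.log_exp]

lemma contDiff_logSumExp : ContDiff ℝ ∞ (logSumExp : (ι → ℝ) → ℝ) := by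
  refine ContDiff.log ?_ fun x => (sum_exp_pos x).ne'
  fun_prop

lemma differentiable_logSumExp : Differentiable ℝ (logSumExp : (ι → ℝ) → ℝ) :=
  contDiff_logSumExp.differentiable (by simp)

lemma softmax_eq_div (i : ι) (x : ι → ℝ) :
    softmax i x = Real.exp (x i) / ∑ j, Real.exp (x j) := by
  rw [softmax, Real.exp_sub, logSumExp, Real.exp_log (sum_exp_pos x)]

lemma sum_softmax (x : ι → ℝ) : ∑ i, softmax i x = 1 := by
  simp only [softmax_eq_div, ← Finset.sum_div]
  exact div_self (sum_exp_pos x).ne'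

lemma contDiff_softmax (i : ι) : ContDiff ℝ ∞ (softmax i) :=
  ((contDiff_apply ℝ ℝ i).sub contDiff_logSumExp).exp

lemma sum_softmaxMonomial_cons (m : Multiset ι) (x : ι → ℝ) :
    ∑ i, softmaxMonomial (i ::ₘ m) x = softmaxMonomial m x := by
  simp only [softmaxMonomial_cons, ← Finset.sum_mul, sum_softmax, one_mul]

lemma contDiff_softmaxMonomial (m : Multiset ι) : ContDiff ℝ ∞ (softmaxMonomial m) := by
  induction m using Multiset.induction with
  | empty => exact contDiff_const
  | cons i m ih =>
    rw [softmaxMonomial_cons]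
    exact (contDiff_softmax i).mul ih

end LogSumExp

section DerivativesOfLogSumExp

open scoped ContDiff

lemma partialDeriv_sum_exp (p : Fin k) :
    partialDeriv p (fun x => ∑ i, Real.exp (x i)) = fun x => Real.exp (x p) := by
  have coord (i : Fin k) : Differentiable ℝ fun x : Fin k → ℝ => x i := by fun_prop
  rw [partialDeriv_sum _ fun i _ => (coord i).exp]
  simp only [partialDeriv_exp (coord _), partialDeriv_apply, mul_ite, mul_one, mul_zero,
    Finset.sum_ite_eq', Finset.mem_univ, if_true]

variable [NeZero k]

lemma partialDeriv_logSumExp (p : Fin k) : partialDeriv p logSumExp = softmax p := by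
  change partialDeriv p (fun x => Real.log (∑ i, Real.exp (x i))) = _
  rw [partialDeriv_comp (f := fun x => ∑ i, Real.exp (x i))
    (fun x => Real.differentiableAt_log (sum_exp_pos x).ne') (by fun_prop), partialDeriv_sum_exp]
  funext x
  simp only [Real.deriv_log, inv_mul_eq_div, softmax_eq_div]

lemma partialDeriv_softmax (p q : Fin k) :
    partialDeriv p (softmax q)
      = fun x => softmax q x * ((if q = p then 1 else 0) - softmax p x) := by
  have coord : Differentiable ℝ fun x : Fin k → ℝ => x q := by fun_prop
  change partialDeriv p (fun x => Real.exp (x q - logSumExp x)) = _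
  rw [partialDeriv_exp (coord.fun_sub differentiable_logSumExp),
    partialDeriv_sub coord differentiable_logSumExp, partialDeriv_apply, partialDeriv_logSumExp]
  rfl

lemma partialDeriv_softmaxMonomial (m : Multiset (Fin k)) (p : Fin k) :
    partialDeriv p (softmaxMonomial m)
      = fun x => m.count p * softmaxMonomial m x - m.card * softmaxMonomial (p ::ₘ m) x := by
  induction m using Multiset.induction with
  | empty =>
    have h : softmaxMonomial (0 : Multiset (Fin k)) = fun _ => 1 := rfl
    funext x
    simp [partialDeriv, h]
  | cons q m ih =>
    rw [softmaxMonomial_cons q, partialDeriv_mul ((contDiff_softmax q).differentiable (by simp))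
      ((contDiff_softmaxMonomial m).differentiable (by simp)), ih, partialDeriv_softmax]
    funext x
    simp only [softmaxMonomial_cons, Multiset.count_cons, Multiset.card_cons, eq_comm (a := p)]
    push_cast
    ring

lemma partialDeriv_comp_logSumExp {G : ℝ → ℝ} (hG : Differentiable ℝ G) (p : Fin k) :
    partialDeriv p (fun x => G (logSumExp x)) = fun x => deriv G (logSumExp x) * softmax p x := by
  rw [partialDeriv_comp (fun _ => hG _) differentiable_logSumExp, partialDeriv_logSumExp]

lemma partialDeriv_comp_logSumExp_mul {G : ℝ → ℝ} (hG : Differentiable ℝ G)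
    (m : Multiset (Fin k)) (p : Fin k) :
    partialDeriv p (fun x => G (logSumExp x) * softmaxMonomial m x)
      = fun x => (deriv G (logSumExp x) - m.card * G (logSumExp x)) * softmaxMonomial (p ::ₘ m) x
          + m.count p * (G (logSumExp x) * softmaxMonomial m x) := by
  have hGL : Differentiable ℝ fun x : Fin k → ℝ => G (logSumExp x) :=
    hG.comp differentiable_logSumExp
  rw [partialDeriv_mul hGL ((contDiff_softmaxMonomial m).differentiable (by simp)),
    partialDeriv_comp_logSumExp hG, partialDeriv_softmaxMonomial]
  funext x
  simp only [softmaxMonomial_cons]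
  ring

lemma contDiff_comp_logSumExp_mul {G : ℝ → ℝ} (hG : ContDiff ℝ ∞ G) (m : Multiset (Fin k)) :
    ContDiff ℝ ∞ fun x => G (logSumExp x) * softmaxMonomial m x :=
  (hG.comp contDiff_logSumExp).mul (contDiff_softmaxMonomial m)

lemma derivSum_succ_comp_logSumExp_mul_le (n : ℕ) {G : ℝ → ℝ} (hG : ContDiff ℝ ∞ G)
    (m : Multiset (Fin k)) (a : Fin k → ℝ) :
    derivSum (n + 1) (fun x => G (logSumExp x) * softmaxMonomial m x) a
      ≤ ∑ p, derivSum n (fun x => (deriv G (logSumExp x) - m.card * G (logSumExp x))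
            * softmaxMonomial (p ::ₘ m) x) a
        + m.card * derivSum n (fun x => G (logSumExp x) * softmaxMonomial m x) a := by
  have hH : ContDiff ℝ ∞ fun t => deriv G t - m.card * G t :=
    (contDiff_infty_iff_deriv.1 hG).2.sub (contDiff_const.mul hG)
  have sum_count : ∑ p, (m.count p : ℝ) = m.card := by
    exact_mod_cast Multiset.sum_count_eq_card (s := Finset.univ) fun _ _ => Finset.mem_univ _
  have card_mul (b : ℝ) : m.card * b = ∑ p, m.count p * b := by rw [← Finset.sum_mul, sum_count]
  rw [card_mul, ← Finset.sum_add_distrib]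
  refine Finset.sum_le_sum fun p _ => ?_
  rw [partialDeriv_comp_logSumExp_mul (hG.differentiable (by simp))]
  refine (derivSum_add_le n (contDiff_comp_logSumExp_mul hH _)
    (contDiff_const.mul (contDiff_comp_logSumExp_mul hG m)) a).trans_eq ?_
  rw [derivSum_const_mul, Nat.abs_cast]

lemma abs_iteratedDeriv_deriv_sub_const_mul_le {G : ℝ → ℝ} (hG : ContDiff ℝ ∞ G) {n : ℕ}
    {c d : ℝ} (hd : 0 ≤ d) (hc : ∀ j ≤ n + 1, ∀ t, |iteratedDeriv j G t| ≤ c) :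
    ∀ j ≤ n, ∀ t, |iteratedDeriv j (fun t => deriv G t - d * G t) t| ≤ (1 + d) * c := by
  intro j hj t
  have hGj : ContDiffAt ℝ j (deriv G) t :=
    ((contDiff_infty_iff_deriv.1 hG).2.of_le (by exact_mod_cast le_top)).contDiffAt
  have hdG : ContDiffAt ℝ j (fun t => d * G t) t :=
    ((contDiff_const.mul hG).of_le (by exact_mod_cast le_top)).contDiffAt
  rw [iteratedDeriv_fun_sub hGj hdG, iteratedDeriv_const_mul_field, ← iteratedDeriv_succ']
  calc |iteratedDeriv (j + 1) G t - d * iteratedDeriv j G t|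
      ≤ |iteratedDeriv (j + 1) G t| + d * |iteratedDeriv j G t| := by
        simpa only [abs_mul, abs_of_nonneg hd] using abs_sub _ (d * iteratedDeriv j G t)
    _ ≤ c + d * c := by
        gcongr
        · exact hc (j + 1) (by omega) t
        · exact hc j (by omega) t
    _ = (1 + d) * c := by ring

lemma derivSum_comp_logSumExp_mul_le (n : ℕ) {G : ℝ → ℝ} (hG : ContDiff ℝ ∞ G) {c : ℝ}
    (hc : ∀ j ≤ n, ∀ t, |iteratedDeriv j G t| ≤ c) (m : Multiset (Fin k)) (a : Fin k → ℝ) :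
    derivSum n (fun x => G (logSumExp x) * softmaxMonomial m x) a
      ≤ (2 * (m.card + n)) ^ n * c * softmaxMonomial m a := by
  have hw := softmaxMonomial_pos m a
  induction n generalizing G c m with
  | zero =>
    have hG0 : |G (logSumExp a)| ≤ c := by simpa using hc 0 le_rfl (logSumExp a)
    simpa [derivSum, abs_mul, abs_of_pos hw] using mul_le_mul_of_nonneg_right hG0 hw.le
  | succ n ih =>
    have hH : ContDiff ℝ ∞ fun t => deriv G t - m.card * G t :=
      (contDiff_infty_iff_deriv.1 hG).2.sub (contDiff_const.mul hG)
    have hHc := abs_iteratedDeriv_deriv_sub_const_mul_le hG m.card.cast_nonneg hc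
    have hc0 : 0 ≤ c := (abs_nonneg _).trans (hc 0 (by omega) 0)
    have pow_le : (2 * (m.card + n) : ℝ) ^ n ≤ (2 * (m.card + n + 1)) ^ n :=
      pow_le_pow_left₀ (by positivity) (by linarith) n
    have card_le : (m.card : ℝ) ≤ m.card + 2 * n + 1 := by exact_mod_cast by omega
    calc derivSum (n + 1) (fun x => G (logSumExp x) * softmaxMonomial m x) a
        ≤ ∑ p, (2 * ((p ::ₘ m).card + n)) ^ n * ((1 + m.card) * c) * softmaxMonomial (p ::ₘ m) a
          + m.card * ((2 * (m.card + n)) ^ n * c * softmaxMonomial m a) := by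
          refine (derivSum_succ_comp_logSumExp_mul_le n hG m a).trans ?_
          gcongr with p
          · exact ih hH hHc _ (softmaxMonomial_pos _ a)
          · exact ih hG (fun j hj => hc j (by omega)) m hw
      _ = ((2 * (m.card + n + 1)) ^ n * (1 + m.card) + (2 * (m.card + n)) ^ n * m.card)
            * c * softmaxMonomial m a := by
          simp only [Multiset.card_cons, Nat.cast_succ, ← Finset.mul_sum, sum_softmaxMonomial_cons]
          ring
      _ ≤ ((2 * (m.card + n + 1)) ^ n * (1 + m.card) + (2 * (m.card + n + 1)) ^ n
            * (m.card + 2 * n + 1)) * c * softmaxMonomial m a := by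
          gcongr ?_ * c * _
          exact add_le_add le_rfl
            (mul_le_mul pow_le card_le (by positivity) (by positivity))
      _ = (2 * (m.card + (n + 1 : ℕ))) ^ (n + 1) * c * softmaxMonomial m a := by
          push_cast
          ring

lemma derivSum_succ_comp_logSumExp_le (n : ℕ) {G : ℝ → ℝ} (hG : ContDiff ℝ ∞ G) {c : ℝ}
    (hc : ∀ j ≤ n, ∀ t, |iteratedDeriv j (deriv G) t| ≤ c) (a : Fin k → ℝ) :
    derivSum (n + 1) (fun x => G (logSumExp x)) a ≤ (2 * (n + 1)) ^ n * c := by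
  have bound (p : Fin k) : derivSum n (partialDeriv p fun x => G (logSumExp x)) a
      ≤ (2 * (n + 1)) ^ n * c * softmax p a := by
    have h := derivSum_comp_logSumExp_mul_le n (contDiff_infty_iff_deriv.1 hG).2 hc {p} a
    simpa [partialDeriv_comp_logSumExp (hG.differentiable (by simp)), softmaxMonomial,
      add_comm] using h
  calc derivSum (n + 1) (fun x => G (logSumExp x)) a
      ≤ ∑ p, (2 * (n + 1)) ^ n * c * softmax p a := Finset.sum_le_sum fun p _ => bound p
    _ = (2 * (n + 1)) ^ n * c := by rw [← Finset.mul_sum, sum_softmax, mul_one]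

end DerivativesOfLogSumExp

section SmoothRect

open scoped ContDiff

lemma exists_abs_iteratedDeriv_le_of_hasCompactSupport {f : ℝ → ℝ} (hf : ContDiff ℝ ∞ f)
    (hsupp : HasCompactSupport f) (n : ℕ) : ∃ M, ∀ j ≤ n, ∀ t, |iteratedDeriv j f t| ≤ M := by
  have supp (j : ℕ) : HasCompactSupport (iteratedDeriv j f) := by
    induction j with
    | zero => rwa [iteratedDeriv_zero]
    | succ j ih => exact iteratedDeriv_succ (f := f) ▸ ih.deriv
  choose M hM using fun j => (supp j).exists_bound_of_continuous
    (hf.continuous_iteratedDeriv j (by exact_mod_cast le_top))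
  obtain ⟨M', hM'⟩ := ((Set.finite_Iic n).image M).bddAbove
  exact ⟨M', fun j hj t => (hM j t).trans (hM' ⟨j, hj, rfl⟩)⟩

/-- A smooth nonincreasing step, equal to `1` on `(-∞, 1/2]` and to `0` on `[1, ∞)`. -/
noncomputable def smoothStep (t : ℝ) : ℝ := Real.smoothTransition (2 * (1 - t))

lemma contDiff_smoothStep : ContDiff ℝ ∞ smoothStep :=
  Real.smoothTransition.contDiff.comp (by fun_prop)

lemma smoothStep_nonneg (t : ℝ) : 0 ≤ smoothStep t := Real.smoothTransition.nonneg _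

lemma smoothStep_le_one (t : ℝ) : smoothStep t ≤ 1 := Real.smoothTransition.le_one _

lemma smoothStep_eq_one {t : ℝ} (ht : t ≤ 1 / 2) : smoothStep t = 1 :=
  Real.smoothTransition.one_of_one_le (by linarith)

lemma smoothStep_eq_zero {t : ℝ} (ht : 1 ≤ t) : smoothStep t = 0 :=
  Real.smoothTransition.zero_of_nonpos (by linarith)

lemma hasCompactSupport_deriv_smoothStep : HasCompactSupport (deriv smoothStep) := by
  refine HasCompactSupport.intro (isCompact_Icc (a := 1 / 2) (b := 1)) fun t ht => ?_
  -- Outside `[1/2, 1]` the step attains its maximum `1` or its minimum `0`.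
  rcases le_total t (1 / 2) with h | h
  · have hmax : IsLocalMax smoothStep t :=
      .of_forall fun s => smoothStep_eq_one h ▸ smoothStep_le_one s
    exact hmax.deriv_eq_zero
  · have h1 : 1 ≤ t := (not_le.1 fun h' => ht ⟨h, h'⟩).le
    have hmin : IsLocalMin smoothStep t :=
      .of_forall fun s => smoothStep_eq_zero h1 ▸ smoothStep_nonneg s
    exact hmin.deriv_eq_zero

lemma exists_abs_iteratedDeriv_deriv_smoothStep_comp_le (n : ℕ) :
    ∃ M, ∀ ℓ : ℝ, 1 ≤ ℓ → ∀ j ≤ n, ∀ t,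
      |iteratedDeriv j (deriv fun u => smoothStep (ℓ⁻¹ * u)) t| ≤ M / ℓ := by
  obtain ⟨M, hM⟩ := exists_abs_iteratedDeriv_le_of_hasCompactSupport
    (contDiff_infty_iff_deriv.1 contDiff_smoothStep).2 hasCompactSupport_deriv_smoothStep n
  refine ⟨M, fun ℓ hℓ j hj t => ?_⟩
  have hℓ0 : 0 < ℓ⁻¹ := by positivity
  rw [← iteratedDeriv_succ', iteratedDeriv_comp_const_mul
    (contDiff_smoothStep.of_le (by exact_mod_cast le_top)), iteratedDeriv_succ']
  calc |ℓ⁻¹ ^ (j + 1) * iteratedDeriv j (deriv smoothStep) (ℓ⁻¹ * t)|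
      = ℓ⁻¹ ^ (j + 1) * |iteratedDeriv j (deriv smoothStep) (ℓ⁻¹ * t)| := by
        rw [abs_mul, abs_of_pos (pow_pos hℓ0 _)]
    _ ≤ ℓ⁻¹ * M := by
        gcongr
        · exact pow_le_of_le_one hℓ0.le (inv_le_one_of_one_le₀ hℓ) j.succ_ne_zero
        · exact hM j hj _
    _ = M / ℓ := inv_mul_eq_div _ _

/-- A smooth function equal to `1` on `rect θ` and to `0` outside `rect (θ + lam)`. The soft maximum
at temperature `lam / (2 log k)` overestimates the maximum by at most `lam / 2`, and the step takes
place on the upper half of `[0, lam]`. -/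
noncomputable def smoothRect (θ : Fin k → ℝ) (lam : ℝ) (x : Fin k → ℝ) : ℝ :=
  smoothStep ((2 * Real.log k)⁻¹ * logSumExp ((2 * Real.log k / lam) • (x - θ)))

lemma one_le_two_mul_log (hk : 2 ≤ k) : 1 ≤ 2 * Real.log k := by
  have h : Real.log 2 ≤ Real.log k := Real.log_le_log two_pos (by exact_mod_cast hk)
  linarith [Real.log_two_gt_d9]

lemma contDiff_smoothRect [NeZero k] (θ : Fin k → ℝ) (lam : ℝ) :
    ContDiff ℝ ∞ (smoothRect θ lam) :=
  contDiff_smoothStep.comp (contDiff_const.mul (contDiff_logSumExp.comp (by fun_prop)))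

lemma smoothRect_nonneg (θ : Fin k → ℝ) (lam : ℝ) (x : Fin k → ℝ) : 0 ≤ smoothRect θ lam x :=
  smoothStep_nonneg _

lemma smoothRect_le_one (θ : Fin k → ℝ) (lam : ℝ) (x : Fin k → ℝ) : smoothRect θ lam x ≤ 1 :=
  smoothStep_le_one _

variable {θ x : Fin k → ℝ} {lam : ℝ}

lemma smoothRect_eq_one (hk : 2 ≤ k) (hlam : 0 < lam) (hx : x ∈ rect θ) :
    smoothRect θ lam x = 1 := by
  have : NeZero k := ⟨by omega⟩
  have hℓ := one_le_two_mul_log hk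
  have nonpos (i : Fin k) : ((2 * Real.log k / lam) • (x - θ)) i ≤ 0 :=
    mul_nonpos_of_nonneg_of_nonpos (by positivity) (sub_nonpos.2 (hx i))
  have h : logSumExp ((2 * Real.log k / lam) • (x - θ)) ≤ Real.log k := by
    simpa using logSumExp_le nonpos
  refine smoothStep_eq_one ?_
  rw [inv_mul_le_iff₀ (by linarith)]
  linarith

lemma smoothRect_eq_zero (hk : 2 ≤ k) (hlam : 0 < lam) (hx : x ∉ rect fun p => θ p + lam) :
    smoothRect θ lam x = 0 := by
  have hℓ := one_le_two_mul_log hk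
  obtain ⟨p, hp⟩ : ∃ p, θ p + lam < x p := by simpa [rect] using hx
  refine smoothStep_eq_zero ?_
  rw [le_inv_mul_iff₀ (by linarith), mul_one]
  calc 2 * Real.log k = 2 * Real.log k / lam * lam := by field_simp
    _ ≤ 2 * Real.log k / lam * (x p - θ p) := by
        gcongr
        linarith
    _ ≤ logSumExp ((2 * Real.log k / lam) • (x - θ)) :=
        le_logSumExp ((2 * Real.log k / lam) • (x - θ)) p

lemma exists_fourthDerivSum_smoothRect_le :
    ∃ C : ℝ, 1 ≤ C ∧ ∀ (k : ℕ), 2 ≤ k → ∀ (θ : Fin k → ℝ) (lam : ℝ), 0 < lam →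
      ∀ a, fourthDerivSum (smoothRect θ lam) a ≤ C * Real.log k ^ 3 / lam ^ 4 := by
  obtain ⟨M, hM⟩ := exists_abs_iteratedDeriv_deriv_smoothStep_comp_le 3
  refine ⟨max 1 (4096 * M), le_max_left _ _, fun k hk θ lam hlam a => ?_⟩
  have : NeZero k := ⟨by omega⟩
  have hℓ := one_le_two_mul_log hk
  have hlog : 0 < Real.log k := by linarith
  have scaling := derivSum_comp_smul_sub 4
    (fun x => smoothStep ((2 * Real.log k)⁻¹ * logSumExp x)) (2 * Real.log k / lam) θ a
  have bound := derivSum_succ_comp_logSumExp_le 3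
    (G := fun u => smoothStep ((2 * Real.log k)⁻¹ * u)) (contDiff_smoothStep.comp (by fun_prop))
    (hM (2 * Real.log k) hℓ) ((2 * Real.log k / lam) • (a - θ))
  rw [abs_of_pos (by positivity)] at scaling
  calc fourthDerivSum (smoothRect θ lam) a
      = (2 * Real.log k / lam) ^ 4 * derivSum 4
          (fun x => smoothStep ((2 * Real.log k)⁻¹ * logSumExp x))
          ((2 * Real.log k / lam) • (a - θ)) :=
        (fourthDerivSum_eq_derivSum _ a).trans scaling
    _ ≤ (2 * Real.log k / lam) ^ 4 * ((2 * (3 + 1)) ^ 3 * (M / (2 * Real.log k))) := by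
        gcongr
        exact_mod_cast bound
    _ = 4096 * M * Real.log k ^ 3 / lam ^ 4 := by
        field_simp
        ring
    _ ≤ _ := by
        gcongr
        exact le_max_right _ _

end SmoothRect

section Expectation

variable {Ω : Type*} [MeasurableSpace Ω] {P : Measure Ω} {X : Ω → Fin k → ℝ}

variable [IsFiniteMeasure P] {θ : Fin k → ℝ} {lam : ℝ}

lemma integrable_comp_of_norm_le {E : Type*} [TopologicalSpace E] [MeasurableSpace E]
    [OpensMeasurableSpace E] {X : Ω → E} (hX : AEMeasurable X P) {ψ : E → ℝ} (hψ : Continuous ψ)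
    {c : ℝ} (hc : ∀ x, ‖ψ x‖ ≤ c) : Integrable (fun ω => ψ (X ω)) P :=
  .of_bound (hψ.measurable.comp_aemeasurable hX).aestronglyMeasurable c (.of_forall fun _ => hc _)

lemma integrable_smoothRect [NeZero k] (hX : AEMeasurable X P) (θ : Fin k → ℝ) (lam : ℝ) :
    Integrable (fun ω => smoothRect θ lam (X ω)) P :=
  integrable_comp_of_norm_le hX (contDiff_smoothRect θ lam).continuous fun x => by
    rw [Real.norm_of_nonneg (smoothRect_nonneg θ lam x)]
    exact smoothRect_le_one θ lam x

lemma measureReal_rect_le_integral_smoothRect (hk : 2 ≤ k) (hX : AEMeasurable X P)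
    (hlam : 0 < lam) : P.real {ω | X ω ∈ rect θ} ≤ ∫ ω, smoothRect θ lam (X ω) ∂P := by
  have : NeZero k := ⟨by omega⟩
  calc P.real {ω | X ω ∈ rect θ} ≤ P.real {ω | 1 ≤ smoothRect θ lam (X ω)} :=
        measureReal_mono fun _ hω => (smoothRect_eq_one hk hlam hω).ge
    _ ≤ ∫ ω, smoothRect θ lam (X ω) ∂P := by
        simpa using mul_meas_ge_le_integral_of_nonneg (.of_forall fun _ => smoothRect_nonneg _ _ _)
          (integrable_smoothRect hX θ lam) 1

lemma integral_smoothRect_le_measureReal_rect (hk : 2 ≤ k) (hlam : 0 < lam) :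
    ∫ ω, smoothRect θ lam (X ω) ∂P ≤ P.real {ω | X ω ∈ rect fun p => θ p + lam} := by
  have h : ENNReal.ofReal (∫ ω, smoothRect θ lam (X ω) ∂P)
      ≤ P {ω | X ω ∈ rect fun p => θ p + lam} :=
    integral_le_measure (fun _ _ => smoothRect_le_one _ _ _)
      fun _ hω => (smoothRect_eq_zero hk hlam hω).le
  exact (ENNReal.ofReal_le_iff_le_toReal (measure_ne_top _ _)).1 h

lemma measureReal_rect_le_add_diff (u v : Fin k → ℝ) :
    P.real {ω | X ω ∈ rect v}
      ≤ P.real {ω | X ω ∈ rect u} + P.real {ω | X ω ∈ rect v \ rect u} :=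
  sub_le_iff_le_add'.1 le_measureReal_sdiff

variable {Ω' : Type*} [MeasurableSpace Ω'] {P' : Measure Ω'} [IsFiniteMeasure P']
  {A : Ω → Fin k → ℝ} {B : Ω' → Fin k → ℝ} {Δ : ℝ}

/-- The expectations of every smooth test function `ψ` under `A` and `B` differ by at most
`Δ ‖ψ⁽⁴⁾‖₁`, provided they both exist. -/
def SmoothTestClose (P : Measure Ω) (P' : Measure Ω') (A : Ω → Fin k → ℝ) (B : Ω' → Fin k → ℝ)
    (Δ : ℝ) : Prop :=
  ∀ ψ : (Fin k → ℝ) → ℝ, IsSmoothTest ψ →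
    Integrable (fun ω => ψ (A ω)) P → Integrable (fun ω => ψ (B ω)) P' →
      |(∫ ω, ψ (A ω) ∂P) - ∫ ω, ψ (B ω) ∂P'| ≤ Δ * fourthDerivNorm ψ

lemma fourthDerivSum_cos_sum (a : Fin k → ℝ) :
    fourthDerivSum (fun x => Real.cos (∑ i, x i)) a = k ^ 4 * |Real.cos (∑ i, a i)| := by
  rw [fourthDerivSum_eq_derivSum, derivSum_comp_sum 4 Real.contDiff_cos]
  simp

lemma isSmoothTest_cos_sum : IsSmoothTest fun x : Fin k → ℝ => Real.cos (∑ i, x i) := by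
  refine ⟨Real.contDiff_cos.comp (by fun_prop), k ^ 4, ?_⟩
  rintro _ ⟨a, rfl⟩
  rw [fourthDerivSum_cos_sum]
  exact mul_le_of_le_one_right (by positivity) (Real.abs_cos_le_one _)

lemma fourthDerivNorm_cos_sum_pos [NeZero k] :
    0 < fourthDerivNorm fun x : Fin k → ℝ => Real.cos (∑ i, x i) := by
  have hk : (0 : ℝ) < k := by exact_mod_cast NeZero.pos k
  refine lt_of_lt_of_le ?_ (le_ciSup isSmoothTest_cos_sum.2 0)
  rw [fourthDerivSum_cos_sum]
  simpa using pow_pos hk 4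

-- It suffices that some bounded test function has a nonzero norm.
lemma SmoothTestClose.nonneg [NeZero k] (hA : AEMeasurable A P) (hB : AEMeasurable B P')
    (h : SmoothTestClose P P' A B Δ) : 0 ≤ Δ := by
  have cont : Continuous fun x : Fin k → ℝ => Real.cos (∑ i, x i) := by fun_prop
  have hcos := h _ isSmoothTest_cos_sum
    (integrable_comp_of_norm_le hA cont fun x => Real.abs_cos_le_one _)
    (integrable_comp_of_norm_le hB cont fun x => Real.abs_cos_le_one _)
  exact nonneg_of_mul_nonneg_left ((abs_nonneg _).trans hcos) fourthDerivNorm_cos_sum_pos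

lemma SmoothTestClose.abs_integral_sub_le [NeZero k] (hA : AEMeasurable A P)
    (hB : AEMeasurable B P') (h : SmoothTestClose P P' A B Δ) {ψ : (Fin k → ℝ) → ℝ}
    (hψ : IsSmoothTest ψ) (hψA : Integrable (fun ω => ψ (A ω)) P)
    (hψB : Integrable (fun ω => ψ (B ω)) P') {c : ℝ} (hc : ∀ a, fourthDerivSum ψ a ≤ c) :
    |(∫ ω, ψ (A ω) ∂P) - ∫ ω, ψ (B ω) ∂P'| ≤ Δ * c :=
  (h ψ hψ hψA hψB).trans
    (mul_le_mul_of_nonneg_left (ciSup_le hc) (h.nonneg hA hB))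

lemma abs_measureReal_rect_sub_le (hk : 2 ≤ k) (hA : AEMeasurable A P) (hB : AEMeasurable B P')
    (hlam : 0 < lam) {ε γ : ℝ}
    (hε : ∀ θ, |(∫ ω, smoothRect θ lam (A ω) ∂P) - ∫ ω, smoothRect θ lam (B ω) ∂P'| ≤ ε)
    (hγ : ∀ θ : Fin k → ℝ, P'.real {ω | B ω ∈ rect (fun p => θ p + lam) \ rect θ} ≤ γ)
    (θ : Fin k → ℝ) :
    |P.real {ω | A ω ∈ rect θ} - P'.real {ω | B ω ∈ rect θ}| ≤ ε + γ := by
  have upper : P.real {ω | A ω ∈ rect θ} ≤ P'.real {ω | B ω ∈ rect θ} + γ + ε :=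
    calc P.real {ω | A ω ∈ rect θ} ≤ ∫ ω, smoothRect θ lam (A ω) ∂P :=
          measureReal_rect_le_integral_smoothRect hk hA hlam
      _ ≤ (∫ ω, smoothRect θ lam (B ω) ∂P') + ε := by linarith [(abs_le.1 (hε θ)).2]
      _ ≤ P'.real {ω | B ω ∈ rect θ} + γ + ε := by
          gcongr
          exact (integral_smoothRect_le_measureReal_rect hk hlam).trans
            ((measureReal_rect_le_add_diff θ _).trans (by gcongr; exact hγ θ))
  set η : Fin k → ℝ := fun p => θ p - lam with hη
  have η_add : (fun p => η p + lam) = θ := by simp [hη]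
  have lower : P'.real {ω | B ω ∈ rect θ} ≤ P.real {ω | A ω ∈ rect θ} + ε + γ :=
    calc P'.real {ω | B ω ∈ rect θ} ≤ P'.real {ω | B ω ∈ rect η} + γ :=
          (measureReal_rect_le_add_diff η θ).trans (by gcongr; exact η_add ▸ hγ η)
      _ ≤ (∫ ω, smoothRect η lam (B ω) ∂P') + γ := by
          gcongr
          exact measureReal_rect_le_integral_smoothRect hk hB hlam
      _ ≤ (∫ ω, smoothRect η lam (A ω) ∂P) + ε + γ := by linarith [(abs_le.1 (hε η)).1]
      _ ≤ P.real {ω | A ω ∈ rect θ} + ε + γ := by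
          gcongr
          simpa only [η_add] using integral_smoothRect_le_measureReal_rect (θ := η) hk hlam
  rw [abs_le]
  constructor <;> linarith

end Expectation

end SmoothToRect

theorem lemma3p3_general :
    ∃ C : ℝ, 1 ≤ C ∧
      ∀ (k : ℕ), 2 ≤ k →
      ∀ (Ω : Type*) [MeasurableSpace Ω] (P : Measure Ω) [IsFiniteMeasure P]
        (Ω' : Type*) [MeasurableSpace Ω'] (P' : Measure Ω') [IsFiniteMeasure P']
        (A : Ω → Fin k → ℝ) (B : Ω' → Fin k → ℝ),
        AEMeasurable A P → AEMeasurable B P' →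
      ∀ (Δ lam γ : ℝ), 0 < lam → SmoothToRect.SmoothTestClose P P' A B Δ →
        (∀ θ : Fin k → ℝ,
          P'.real {ω | B ω ∈ SmoothToRect.rect (fun p => θ p + lam) \ SmoothToRect.rect θ} ≤ γ) →
      ∀ θ : Fin k → ℝ,
        |P.real {ω | A ω ∈ SmoothToRect.rect θ} - P'.real {ω | B ω ∈ SmoothToRect.rect θ}|
          ≤ C * Δ * Real.log k ^ 3 / lam ^ 4 + γ := by
  obtain ⟨C, hC, norm_le⟩ := SmoothToRect.exists_fourthDerivSum_smoothRect_le
  refine ⟨C, hC, fun k hk Ω _ P _ Ω' _ P' _ A B hA hB Δ lam γ hlam hΔ hγ =>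
    SmoothToRect.abs_measureReal_rect_sub_le hk hA hB hlam (fun θ => ?_) hγ⟩
  have : NeZero k := ⟨by omega⟩
  have smooth : SmoothToRect.IsSmoothTest (SmoothToRect.smoothRect θ lam) :=
    ⟨SmoothToRect.contDiff_smoothRect θ lam, _, Set.forall_mem_range.2 (norm_le k hk θ lam hlam)⟩
  refine (hΔ.abs_integral_sub_le hA hB smooth
    (SmoothToRect.integrable_smoothRect hA θ lam) (SmoothToRect.integrable_smoothRect hB θ lam)
    (norm_le k hk θ lam hlam)).trans_eq ?_
  ring

theorem lemma3p3 :
    ∃ C : ℝ, 0 < C ∧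
      ∀ (k : ℕ), 2 ≤ k →
      ∀ (Ω : Type*) [MeasurableSpace Ω] (P : Measure Ω) [IsProbabilityMeasure P]
        (Ω' : Type*) [MeasurableSpace Ω'] (P' : Measure Ω') [IsProbabilityMeasure P']
        (A : Ω → Fin k → ℝ) (B : Ω' → Fin k → ℝ),
        AEMeasurable A P → AEMeasurable B P' →
      ∀ (Δ : ℝ) (g : Set.Icc (0 : ℝ) 1 → Set.Icc (0 : ℝ) 1),
        (∀ ψ : (Fin k → ℝ) → ℝ, SmoothToRect.IsSmoothTest ψ →
          Integrable (fun ω => ψ (A ω)) P → Integrable (fun ω => ψ (B ω)) P' →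
          |(∫ ω, ψ (A ω) ∂P) - ∫ ω, ψ (B ω) ∂P'| ≤ Δ * SmoothToRect.fourthDerivNorm ψ) →
        (∀ (lam : Set.Icc (0 : ℝ) 1) (θ : Fin k → ℝ),
          P'.real {ω | B ω ∈ SmoothToRect.rect (fun p => θ p + (lam : ℝ)) \ SmoothToRect.rect θ}
            ≤ (g lam : ℝ)) →
      ∀ (θ : Fin k → ℝ) (lam : Set.Icc (0 : ℝ) 1), 0 < (lam : ℝ) → (lam : ℝ) < 1 →
        |P.real {ω | A ω ∈ SmoothToRect.rect θ} - P'.real {ω | B ω ∈ SmoothToRect.rect θ}|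
          ≤ C * Δ * Real.log k ^ 3 / (lam : ℝ) ^ 4 + C * (g lam : ℝ) := by
  obtain ⟨C, hC, bound⟩ := lemma3p3_general
  refine ⟨C, by linarith, fun k hk Ω _ P _ Ω' _ P' _ A B hA hB Δ g hΔ hg θ lam hlam _ =>
    (bound k hk Ω P Ω' P' A B hA hB Δ lam (g lam) hlam hΔ (hg lam) θ).trans ?_⟩
  gcongr
  exact le_mul_of_one_le_left (g lam).2.1 hC
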